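/- Let $k\ge 1$ and $r\ge\max(k+1,4)$ be integers, $T>0$, and let $\boldsymbol w\in C^r(\mathbb R^2\times[0,T];\mathbb R^2)$ be a velocity field such that, for every $s\in[0,T]$ and $\boldsymbol x\in\mathbb R^2$, the problem $\boldsymbol X'(t)=\boldsymbol w(\boldsymbol X(t),t)$, $\boldsymbol X(s)=\boldsymbol x$ has a solution on $[s,T]$; denote it by $\boldsymbol X(t;s,\boldsymbol x)$. Fix an explicit Runge–Kutta scheme of order $k$ (coefficients $a_{ij},b_i,c_i$ with $c_i\in[0,1]$), a length $L>0$ and a constant $M\ge 0$. For integers $N,J\ge1$ put $\tau=T/N$, $t_n=n\tau$, $\eta=L/J$, $L_j=j\eta$. Let $\boldsymbol X^{n,n+1}=\boldsymbol X(t_{n+1};t_n,\cdot)$, let $\boldsymbol X_\tau^{n,n+1}:\mathbb R^2\to\mathbb R^2$ be one Runge–Kutta step of size $\tau$ from time $t_n$, and for $m\le n$ let $\boldsymbol X^{m,n}$ and $\boldsymbol X_\tau^{m,n}$ be the compositions of the one-step maps from level $m$ to level $n$ (the identity if $m=n$). Let the initial closed boundary be parametrized by an $L$-periodic $C^r$ map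 $\hat{\boldsymbol\chi}_0:\mathbb R\to\mathbb R^2$. The markers are $\boldsymbol p_j^0=\hat{\boldsymbol\chi}_0(L_j)$ and $\boldsymbol p_j^{n+1}=\boldsymbol X_\tau^{n,n+1}(\boldsymbol p_j^n)$, $0\le j\le J$. For $0\le n\le N$ the tracked boundary $\boldsymbol\chi_n$ is the $L$-periodic $C^2$ cubic spline with nodes $L_0,\dots,L_J$ and $\boldsymbol\chi_n(L_j)=\boldsymbol p_j^n$ (in particular, $\boldsymbol\chi_0$ is the spline through the initial markers). Assume (A1) $\ \|\boldsymbol X^{0,n}\circ\hat{\boldsymbol\chi}_0\|_{C^r([0,L])}+\|\boldsymbol X_\tau^{0,n}\circ\hat{\boldsymbol\chi}_0\|_{C^r([0,L])}\le M$ for all $0\le n\le N$. Then there is a constant $C>0$, depending only on $k,r,T,\boldsymbol w$, the Runge–Kutta scheme, $L$ and $M$ (in particular not on $N$, $J$, $\tau$, $\eta$, $m$, $n$), such that for all integers $0\le m\le n\le N$ with $n-k\le m$ and for $\mu=0,1$, $$\big\|\boldsymbol\chi_n-\boldsymbol X_\tau^{m,n}\circ\boldsymbol\chi_m\big\|_{C^\mu([0,L])}\le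 C\,\eta^{-\mu}\sum_{i=0}^{k-1}\Big[\tau^{i+1}\eta^{\min(4,r-i)}+\tau^{k+1}\Big].$$ -/

import Mathlib

open Set Filter Topology Asymptotics
open scoped NNReal ENNReal ContDiff

noncomputable section

/-- The Euclidean plane. -/
abbrev Plane := EuclideanSpace ℝ (Fin 2)

/-! ### Trajectories and the exact flow map -/

/-- `Y` solves `Y' (t) = w (Y t, t)` on `[s, T]` with `Y s = x`
(one-sided derivatives at the two end points). -/
def IsTrajectory {E : Type*} [NormedAddCommGroup E] [NormedSpace ℝ E]
    (w : E → ℝ → E) (T s : ℝ) (x : E) (Y : ℝ → E) : Prop :=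
  Y s = x ∧ ∀ t ∈ Icc s T, HasDerivWithinAt Y (w (Y t) t) (Icc s T) t

/-- The flow map `X(t; s, x)`: the value at time `t` of the trajectory which is at `x` at time `s`.
It is meaningful for `s ≤ t ≤ T` whenever a trajectory exists on `[s, T]`
(it is then unique on `[s, T]` for a `C¹` velocity). -/
def flowMap (w : Plane → ℝ → Plane) (T t s : ℝ) (x : Plane) : Plane :=
  Classical.epsilon (IsTrajectory w T s x) t

/-- The velocity `w` moves every point of the plane from every time `s ∈ [0, T]` up to time `T`. -/
def HasGlobalFlow (w : Plane → ℝ → Plane) (T : ℝ) : Prop :=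
  ∀ s ∈ Icc 0 T, ∀ x : Plane, ∃ Y : ℝ → Plane, IsTrajectory w T s x Y

/-! ### Explicit Runge-Kutta schemes -/

/-- Coefficients of an explicit Runge-Kutta scheme. The stages are numbered `0, …, stages - 1`;
only the entries `a i j` with `j < i < stages` and `b i`, `c i` with `i < stages` are used. -/
structure ExplicitRK where
  stages : ℕ
  a : ℕ → ℕ → ℝ
  b : ℕ → ℝ
  c : ℕ → ℝ

namespace ExplicitRK

variable {E : Type*} [NormedAddCommGroup E] [NormedSpace ℝ E]

/-- Stage `i` of one step of size `τ` from `x` at time `t`: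
`x⁽ⁱ⁾ = x + τ ∑_{j < i} a i j • w (x⁽ʲ⁾, t + c j τ)`. -/
def stage (R : ExplicitRK) (w : E → ℝ → E) (t τ : ℝ) (x : E) (i : ℕ) : E :=
  x + τ • ∑ j : Fin i, R.a i j • w (stage R w t τ x j) (t + R.c j * τ)
termination_by i
decreasing_by exact j.isLt

/-- One step of size `τ` from `x` at time `t`. -/
def step (R : ExplicitRK) (w : E → ℝ → E) (t τ : ℝ) (x : E) : E :=
  x + τ • ∑ i ∈ Finset.range R.stages, R.b i • w (R.stage w t τ x i) (t + R.c i * τ)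

/-- The scheme has order (at least) `k`: for every smooth system of ordinary differential
equations and every solution of it, the error of one step of size `τ` is `O(τ ^ (k + 1))`. -/
def HasOrder (R : ExplicitRK) (k : ℕ) : Prop :=
  ∀ (d : ℕ) (f : EuclideanSpace ℝ (Fin d) → ℝ → EuclideanSpace ℝ (Fin d)),
    ContDiff ℝ ∞ (fun z : EuclideanSpace ℝ (Fin d) × ℝ => f z.1 z.2) →
    ∀ (t₀ t₁ : ℝ) (x : EuclideanSpace ℝ (Fin d)) (Y : ℝ → EuclideanSpace ℝ (Fin d)),
      t₀ < t₁ → IsTrajectory f t₁ t₀ x Y →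
      (fun τ : ℝ => R.step f t₀ τ x - Y (t₀ + τ)) =O[𝓝[>] 0] (fun τ : ℝ => τ ^ (k + 1))

end ExplicitRK

/-! ### One-step and multi-step maps on the time grid `t_n = n τ`, `τ = T / N` -/

/-- The exact one-step map `X^{n,n+1} = X(t_{n+1}; t_n, ·)`. -/
def exactStep (w : Plane → ℝ → Plane) (T : ℝ) (N n : ℕ) : Plane → Plane :=
  flowMap w T ((n + 1 : ℕ) * (T / N)) (n * (T / N))

/-- The discrete one-step map `X_τ^{n,n+1}`: one Runge-Kutta step from `t_n` to `t_{n+1}`. -/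
def rkStep (R : ExplicitRK) (w : Plane → ℝ → Plane) (T : ℝ) (N n : ℕ) : Plane → Plane :=
  R.step w (n * (T / N)) (T / N)

/-- `compSteps F m i = F (m + i - 1) ∘ ⋯ ∘ F (m + 1) ∘ F m`. -/
def compSteps (F : ℕ → Plane → Plane) (m : ℕ) : ℕ → Plane → Plane
  | 0 => id
  | i + 1 => F (m + i) ∘ compSteps F m i

/-- The map from level `m` to level `n` (`m ≤ n`), where `F j` is the map from `j` to `j + 1`. -/
def multiStep (F : ℕ → Plane → Plane) (m n : ℕ) : Plane → Plane :=
  compSteps F m (n - m)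

/-- `X^{m,n}`. -/
def exactMap (w : Plane → ℝ → Plane) (T : ℝ) (N m n : ℕ) : Plane → Plane :=
  multiStep (exactStep w T N) m n

/-- `X_τ^{m,n}`. -/
def rkMap (R : ExplicitRK) (w : Plane → ℝ → Plane) (T : ℝ) (N m n : ℕ) : Plane → Plane :=
  multiStep (rkStep R w T N) m n

/-! ### Norms, splines, and boundary tracking -/

open Classical in
/-- The norm of `C^r([0, L])`, equal to `∞` for a function that is not of class `C^r` on `[0, L]`
(one-sided derivatives at the end points). -/
def crNorm (r : ℕ) (L : ℝ) (f : ℝ → Plane) : ℝ≥0∞ :=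
  if ContDiffOn ℝ r f (Icc 0 L) then
    ∑ j ∈ Finset.range (r + 1), ⨆ l ∈ Icc 0 L, ‖iteratedDerivWithin j f (Icc 0 L) l‖ₑ
  else ∞

/-- `σ` is the `L`-periodic cubic spline with the `J + 1` equidistant nodes `L_j = j (L / J)` and
the nodal values `p j`, `0 ≤ j ≤ J`: it is `L`-periodic, of class `C²`, cubic between
neighbouring nodes, and takes the value `p j` at `L_j`. -/
structure IsPeriodicCubicSpline (L : ℝ) (J : ℕ) (p : ℕ → Plane) (σ : ℝ → Plane) : Prop where
  periodic : Function.Periodic σ L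
  contDiff : ContDiff ℝ 2 σ
  cubic : ∀ j < J, ∃ a₀ a₁ a₂ a₃ : Plane,
    ∀ l ∈ Icc (j * (L / J)) ((j + 1 : ℕ) * (L / J)),
      σ l = a₀ + l • a₁ + l ^ 2 • a₂ + l ^ 3 • a₃
  interp : ∀ j ≤ J, σ (j * (L / J)) = p j

/-- The markers: `p_j^0 = χ₀ (L_j)` and `p_j^{n+1} = X_τ^{n,n+1} (p_j^n)`. -/
def marker (R : ExplicitRK) (w : Plane → ℝ → Plane) (T : ℝ) (N : ℕ) (L : ℝ) (J : ℕ)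
    (χ₀ : ℝ → Plane) : ℕ → ℕ → Plane
  | 0, j => χ₀ (j * (L / J))
  | n + 1, j => rkStep R w T N n (marker R w T N L J χ₀ n j)

/-- `χ 0, …, χ N` is the output of the tracking algorithm: `χ n` is the periodic cubic spline
through the markers at time `t_n`. -/
def IsTrackedBoundary (R : ExplicitRK) (w : Plane → ℝ → Plane) (T : ℝ) (N : ℕ) (L : ℝ) (J : ℕ)
    (χ₀ : ℝ → Plane) (χ : ℕ → ℝ → Plane) : Prop :=
  ∀ n ≤ N, IsPeriodicCubicSpline L J (marker R w T N L J χ₀ n) (χ n)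

/-- The exact boundary `X^{0,n} ∘ χ₀` and the Runge-Kutta boundary `X_τ^{0,n} ∘ χ₀` are bounded
in `C^r([0, L])` by `M` at all time levels. -/
def BoundedBoundaries (r : ℕ) (R : ExplicitRK) (w : Plane → ℝ → Plane) (T : ℝ) (N : ℕ) (L : ℝ)
    (χ₀ : ℝ → Plane) (M : ℝ≥0) : Prop :=
  ∀ n ≤ N, crNorm r L (exactMap w T N 0 n ∘ χ₀) + crNorm r L (rkMap R w T N 0 n ∘ χ₀) ≤ M

end

/-! Write a Runge-Kutta step as `x + τ • Φ x`. By `ExplicitRK.uniformlyBoundedCn_increment` the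
increment `Φ` has derivatives bounded on balls, uniformly in time and step size. Let `g` be the
Runge-Kutta image of the exact initial curve; it is bounded in `C⁴`, and the tracked boundary `σ` is
its spline interpolant. Spline interpolation is linear, so the change `σ' - σ` over one step is the
interpolant of `τ • Φ ∘ g`. By `IsPeriodicCubicSpline.norm_sub_le` the change differs from this
function by `O(τ η ^ 4)`, not merely `O(η ^ 4)`. Replacing `Φ ∘ g` by `Φ ∘ σ` costs another `τ · O(η
^ 4)`, since `Φ` is Lipschitz on bounded sets. Derivatives lose one power of `η`. This is
`UniformlyBoundedCn.exists_norm_spline_step_sub_le`.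

Runge-Kutta steps are also Lipschitz in `C¹` on bounded sets, so at most `k` such errors accumulate
with a constant depending on `k` (`exists_tracking_error_le`). The result, `O(τ η ^ (4 - μ))`, is
already controlled by the summand `i = 0` of the asserted bound, because `r ≥ 4`. -/

/-! ### Estimates on a single segment -/

/-- A function vanishing at both end points of a segment is controlled, together with its first
derivative, by its second derivative. -/
theorem norm_le_of_eq_zero_endpoints {E : Type*} [NormedAddCommGroup E] [NormedSpace ℝ E]
    {f f' f'' : ℝ → E} {a b B : ℝ} (hab : a < b)
    (hf : ∀ x ∈ Icc a b, HasDerivWithinAt f (f' x) (Icc a b) x)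
    (hf' : ∀ x ∈ Icc a b, HasDerivWithinAt f' (f'' x) (Icc a b) x)
    (hB : ∀ x ∈ Icc a b, ‖f'' x‖ ≤ B) (ha : f a = 0) (hb : f b = 0) :
    ∀ x ∈ Icc a b, ‖f x‖ ≤ 2 * B * (b - a) ^ 2 ∧ ‖f' x‖ ≤ 2 * B * (b - a) := by
  have hab' : 0 < b - a := sub_pos.2 hab
  have hB0 : 0 ≤ B := (norm_nonneg _).trans (hB a (left_mem_Icc.2 hab.le))
  have h1 : ∀ x ∈ Icc a b, ‖f' x - f' a‖ ≤ B * (b - a) := fun x hx =>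
    (norm_image_sub_le_of_norm_deriv_le_segment' hf'
      (fun y hy => hB y (Ico_subset_Icc_self hy)) x hx).trans (by gcongr; exact hx.2)
  -- Vector-valued substitute for Rolle: `f x - (x - a) • f' a` vanishes at `a`, has derivative at
  -- most `B * (b - a)`, and equals `-(b - a) • f' a` at `b`.
  have h2 : ‖f' a‖ ≤ B * (b - a) := by
    have key := norm_image_sub_le_of_norm_deriv_le_segment'
      (f := fun x => f x - (x - a) • f' a) (f' := fun x => f' x - f' a) (C := B * (b - a))
      (fun x hx => by
        have := (hf x hx).sub ((((hasDerivWithinAt_id x (Icc a b)).sub_const a)).smul_const (f' a))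
        rw [one_smul] at this
        exact this)
      (fun x hx => h1 x (Ico_subset_Icc_self hx)) b (right_mem_Icc.2 hab.le)
    simp only [ha, hb, sub_self, zero_smul, zero_sub, sub_zero, norm_neg, norm_smul,
      Real.norm_eq_abs, abs_of_pos hab'] at key
    nlinarith [norm_nonneg (f' a)]
  have h3 : ∀ x ∈ Icc a b, ‖f' x‖ ≤ 2 * B * (b - a) := fun x hx => by
    have := norm_add_le (f' x - f' a) (f' a)
    rw [sub_add_cancel] at this
    linarith [h1 x hx]
  refine fun x hx => ⟨?_, h3 x hx⟩
  have := norm_image_sub_le_of_norm_deriv_le_segment' hf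
    (fun y hy => h3 y (Ico_subset_Icc_self hy)) x hx
  rw [ha, sub_zero] at this
  refine this.trans ?_
  rw [pow_two, ← mul_assoc]
  gcongr
  exact hx.2

section Interval

variable {E : Type*} [NormedAddCommGroup E] [NormedSpace ℝ E]
  {e e₁ e₂ e₃ e₄ : ℝ → E} {a b B : ℝ}

/-- On a segment, a function vanishing at both end points agrees, up to its fourth derivative,
with the cubic polynomial which has the same second derivatives at the end points. -/
theorem hermite_estimate (hab : a < b)
    (h0 : ∀ x ∈ Icc a b, HasDerivWithinAt e (e₁ x) (Icc a b) x)
    (h1 : ∀ x ∈ Icc a b, HasDerivWithinAt e₁ (e₂ x) (Icc a b) x)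
    (h2 : ∀ x ∈ Icc a b, HasDerivWithinAt e₂ (e₃ x) (Icc a b) x)
    (h3 : ∀ x ∈ Icc a b, HasDerivWithinAt e₃ (e₄ x) (Icc a b) x)
    (hB : ∀ x ∈ Icc a b, ‖e₄ x‖ ≤ B) (ha : e a = 0) (hb : e b = 0) :
    ‖e₁ a + ((b - a) / 6) • ((2 : ℝ) • e₂ a + e₂ b)‖ ≤ 4 * B * (b - a) ^ 3 ∧
    ‖e₁ b - ((b - a) / 6) • (e₂ a + (2 : ℝ) • e₂ b)‖ ≤ 4 * B * (b - a) ^ 3 ∧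
    ∀ x ∈ Icc a b, ‖e₂ x‖ ≤ 2 * B * (b - a) ^ 2 + max ‖e₂ a‖ ‖e₂ b‖ := by
  have hη : 0 < b - a := sub_pos.2 hab
  set η := b - a with hηdef
  -- The cubic vanishing at `a` and `b` whose second derivative `q₂` interpolates `e₂` linearly;
  -- `q₁`, `q₂`, `q₃` are its successive derivatives.
  let q : ℝ → E := fun x =>
    ((x - a) ^ 2 / 2 - (x - a) ^ 3 / (6 * η) - (x - a) * η / 3) • e₂ a +
      ((x - a) ^ 3 / (6 * η) - (x - a) * η / 6) • e₂ b
  let q₁ : ℝ → E := fun x =>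
    ((x - a) - (x - a) ^ 2 / (2 * η) - η / 3) • e₂ a + ((x - a) ^ 2 / (2 * η) - η / 6) • e₂ b
  let q₂ : ℝ → E := fun x => (1 - (x - a) / η) • e₂ a + ((x - a) / η) • e₂ b
  let q₃ : E := (-(1 / η)) • e₂ a + (1 / η) • e₂ b
  have hid : ∀ x, HasDerivAt (fun x : ℝ => x - a) 1 x := fun x => (hasDerivAt_id x).sub_const a
  have hq : ∀ x, HasDerivAt q (q₁ x) x := fun x => by
    refine HasDerivAt.add (HasDerivAt.smul_const ?_ _) (HasDerivAt.smul_const ?_ _)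
    · refine ((((hid x).pow 2).div_const 2).sub (((hid x).pow 3).div_const (6 * η))).sub
        (((hid x).mul_const η).div_const 3) |>.congr_deriv ?_
      field_simp
      norm_num
      ring
    · refine (((hid x).pow 3).div_const (6 * η)).sub
        (((hid x).mul_const η).div_const 6) |>.congr_deriv ?_
      field_simp
      norm_num
      ring
  have hq₁ : ∀ x, HasDerivAt q₁ (q₂ x) x := fun x => by
    refine HasDerivAt.add (HasDerivAt.smul_const ?_ _) (HasDerivAt.smul_const ?_ _)
    · refine (((hid x).sub (((hid x).pow 2).div_const (2 * η))).sub_const (η / 3)).congr_deriv ?_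
      field_simp
      norm_num
      ring
    · refine ((((hid x).pow 2).div_const (2 * η)).sub_const (η / 6)).congr_deriv ?_
      field_simp
      norm_num
      ring
  have hq₂ : ∀ x, HasDerivAt q₂ q₃ x := fun x => by
    refine HasDerivAt.add (HasDerivAt.smul_const ?_ _) (HasDerivAt.smul_const ?_ _)
    · simpa using ((hid x).div_const η).const_sub 1
    · exact (hid x).div_const η
  have hqa : q a = 0 := by simp [q]
  have hqb : q b = 0 := by
    have hc1 : (b - a) ^ 2 / 2 - (b - a) ^ 3 / (6 * η) - (b - a) * η / 3 = 0 := by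
      rw [← hηdef]; field_simp; norm_num
    have hc2 : (b - a) ^ 3 / (6 * η) - (b - a) * η / 6 = 0 := by
      rw [← hηdef]; field_simp; norm_num
    simp only [q, hc1, hc2, zero_smul, add_zero]
  have hq₂a : q₂ a = e₂ a := by simp [q₂]
  have hq₂b : q₂ b = e₂ b := by simp [q₂, ← hηdef, div_self hη.ne']
  have hq₁a : q₁ a = -((η / 6) • ((2 : ℝ) • e₂ a + e₂ b)) := by
    simp only [q₁, sub_self]; module
  have hq₁b : q₁ b = (η / 6) • (e₂ a + (2 : ℝ) • e₂ b) := by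
    have hc1 : (b - a) - (b - a) ^ 2 / (2 * η) - η / 3 = η / 6 := by
      rw [← hηdef]; field_simp; norm_num
    have hc2 : (b - a) ^ 2 / (2 * η) - η / 6 = η / 6 * 2 := by
      rw [← hηdef]; field_simp; norm_num
    simp only [q₁, hc1, hc2]; module
  -- The two-point estimate is used twice: on `e₂ - q₂`, whose second derivative is `e₄` because
  -- `q₃` is constant, and then on `e - q`, with the bound just obtained.
  have hρ : ∀ x ∈ Icc a b, ‖e₂ x - q₂ x‖ ≤ 2 * B * η ^ 2 := fun x hx =>
    (norm_le_of_eq_zero_endpoints hab (f := fun x => e₂ x - q₂ x) (f' := fun x => e₃ x - q₃)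
      (f'' := e₄)
      (fun x hx => (h2 x hx).sub (hq₂ x).hasDerivWithinAt)
      (fun x hx => (h3 x hx).sub_const q₃) hB (by simp [hq₂a]) (by simp [hq₂b]) x hx).1
  have hρ₁ : ∀ x ∈ Icc a b, ‖e₁ x - q₁ x‖ ≤ 4 * B * η ^ 3 := fun x hx => by
    refine (norm_le_of_eq_zero_endpoints hab (f := fun x => e x - q x) (f' := fun x => e₁ x - q₁ x)
      (f'' := fun x => e₂ x - q₂ x)
      (fun x hx => (h0 x hx).sub (hq x).hasDerivWithinAt)
      (fun x hx => (h1 x hx).sub (hq₁ x).hasDerivWithinAt) hρ (by simp [hqa, ha])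
      (by simp [hqb, hb]) x hx).2.trans (le_of_eq ?_)
    rw [← hηdef]; ring
  refine ⟨?_, ?_, fun x hx => ?_⟩
  · simpa only [hq₁a, sub_neg_eq_add] using hρ₁ a (left_mem_Icc.2 hab.le)
  · simpa only [hq₁b] using hρ₁ b (right_mem_Icc.2 hab.le)
  · have hxη : (x - a) / η ≤ 1 := (div_le_one hη).2 (by linarith [hx.2])
    have hx0 : 0 ≤ (x - a) / η := div_nonneg (by linarith [hx.1]) hη.le
    have hq₂x : ‖q₂ x‖ ≤ max ‖e₂ a‖ ‖e₂ b‖ := by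
      refine (norm_add_le _ _).trans ?_
      rw [norm_smul, norm_smul, Real.norm_of_nonneg hx0, Real.norm_of_nonneg (sub_nonneg.2 hxη)]
      nlinarith [le_max_left ‖e₂ a‖ ‖e₂ b‖, le_max_right ‖e₂ a‖ ‖e₂ b‖]
    have := norm_add_le (e₂ x - q₂ x) (q₂ x)
    rw [sub_add_cancel] at this
    linarith [hρ x hx]

end Interval

/-! ### The cyclic system for second derivatives at the nodes -/

section Cyclic

variable {E : Type*} [NormedAddCommGroup E] [NormedSpace ℝ E]

/-- Diagonal dominance at an entry of maximal norm: `4 D ≤ B + 2 D`. -/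
theorem norm_le_of_tridiagonal {x y z : E} {B D : ℝ} (h : ‖x + (4 : ℝ) • y + z‖ ≤ B)
    (hx : ‖x‖ ≤ D) (hz : ‖z‖ ≤ D) (hy : ‖y‖ = D) : D ≤ B / 2 := by
  have h1 := norm_sub_le (x + (4 : ℝ) • y + z) (x + z)
  have h2 := norm_add_le x z
  have h3 : x + (4 : ℝ) • y + z - (x + z) = (4 : ℝ) • y := by abel
  rw [h3, norm_smul] at h1
  norm_num at h1
  linarith

/-- Stability of the cyclic diagonally dominant system of the second derivatives of a spline. -/
theorem norm_le_of_cyclic_tridiagonal {J : ℕ} (hJ : 1 ≤ J) (d : ℕ → E) {B : ℝ} (hper : d J = d 0)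
    (h : ∀ j, j + 1 < J → ‖d j + (4 : ℝ) • d (j + 1) + d (j + 2)‖ ≤ B)
    (h0 : ‖d (J - 1) + (4 : ℝ) • d 0 + d 1‖ ≤ B) :
    ∀ j ≤ J, ‖d j‖ ≤ B / 2 := by
  -- Maximum principle: use the equation centred at an entry of largest norm. The indices `0` and
  -- `J` share the wrap-around equation.
  obtain ⟨i, hi, hmax⟩ := Finset.exists_max_image (Finset.range (J + 1)) (fun j => ‖d j‖)
    ⟨0, by simp⟩
  have hmax' : ∀ j ≤ J, ‖d j‖ ≤ ‖d i‖ := fun j hj => hmax j (by simp; omega)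
  have hiJ : i ≤ J := by simp at hi; omega
  suffices hD : ‖d i‖ ≤ B / 2 from fun j hj => (hmax' j hj).trans hD
  rcases Nat.eq_zero_or_pos i with rfl | hi0
  · exact norm_le_of_tridiagonal h0 (hmax' _ (by omega)) (hmax' _ hJ) rfl
  rcases hiJ.lt_or_eq with hlt | rfl
  · obtain ⟨j, rfl⟩ : ∃ j, i = j + 1 := ⟨i - 1, by omega⟩
    exact norm_le_of_tridiagonal (h j hlt) (hmax' _ (by omega)) (hmax' _ (by omega)) rfl
  · exact norm_le_of_tridiagonal h0 (hmax' _ (by omega)) (hmax' _ hJ) (by rw [hper])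

/-- Here `u` is the first derivative of the error at a node, expressed through second derivatives
from the cell on its left and from the cell on its right. Subtracting eliminates `u`; this is where
continuity of the spline's first derivative across nodes enters. -/
theorem norm_tridiagonal_le {x y z u : E} {η B : ℝ} (hη : 0 < η)
    (h1 : ‖u - (η / 6) • (x + (2 : ℝ) • y)‖ ≤ 4 * B * η ^ 3)
    (h2 : ‖u + (η / 6) • ((2 : ℝ) • y + z)‖ ≤ 4 * B * η ^ 3) :
    ‖x + (4 : ℝ) • y + z‖ ≤ 48 * B * η ^ 2 := by
  have h3 := norm_sub_le (u + (η / 6) • ((2 : ℝ) • y + z)) (u - (η / 6) • (x + (2 : ℝ) • y))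
  have h4 : u + (η / 6) • ((2 : ℝ) • y + z) - (u - (η / 6) • (x + (2 : ℝ) • y))
      = (η / 6) • (x + (4 : ℝ) • y + z) := by module
  rw [h4, norm_smul, Real.norm_of_nonneg (by positivity)] at h3
  have h5 : η / 6 * ‖x + (4 : ℝ) • y + z‖ ≤ η / 6 * (48 * B * η ^ 2) := by nlinarith
  exact le_of_mul_le_mul_left h5 (by positivity)

end Cyclic

/-! ### Interpolation error of periodic cubic splines -/

theorem ContDiff.hasDerivAt_iteratedDeriv {E : Type*} [NormedAddCommGroup E] [NormedSpace ℝ E]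
    {f : ℝ → E} {n : ℕ} (hf : ContDiff ℝ n f) {i : ℕ} (hi : i < n) (x : ℝ) :
    HasDerivAt (iteratedDeriv i f) (iteratedDeriv (i + 1) f x) x := by
  rw [iteratedDeriv_succ]
  exact (hf.differentiable_iteratedDeriv i (by exact_mod_cast hi) x).hasDerivAt

theorem Function.Periodic.iteratedDeriv {E : Type*} [NormedAddCommGroup E] [NormedSpace ℝ E]
    {f : ℝ → E} {L : ℝ} (hf : Function.Periodic f L) (i : ℕ) :
    Function.Periodic (iteratedDeriv i f) L := fun x => by
  have h : (fun z => f (z + L)) = f := funext hf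
  conv_rhs => rw [← h]
  rw [iteratedDeriv_comp_add_const]

theorem exists_mem_Icc_node {L : ℝ} (hL : 0 < L) {J : ℕ} (hJ : 1 ≤ J) {x : ℝ} (hx : x ∈ Icc 0 L) :
    ∃ j < J, x ∈ Icc ((j : ℝ) * (L / J)) ((j + 1 : ℕ) * (L / J)) := by
  have hJ' : (0 : ℝ) < J := by exact_mod_cast hJ
  have hη : 0 < L / J := by positivity
  have hJη : (J : ℝ) * (L / J) = L := by field_simp
  rcases hx.2.lt_or_eq with hlt | rfl
  · have hq : 0 ≤ x / (L / J) := div_nonneg hx.1 hη.le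
    refine ⟨⌊x / (L / J)⌋₊, ?_, ?_, ?_⟩
    · rw [Nat.floor_lt hq, div_lt_iff₀ hη]; linarith
    · exact (le_div_iff₀ hη).1 (Nat.floor_le hq)
    · push_cast
      exact ((div_lt_iff₀ hη).1 (Nat.lt_floor_add_one _)).le
  · refine ⟨J - 1, by omega, ?_, ?_⟩
    · nlinarith [show ((J - 1 : ℕ) : ℝ) ≤ J by exact_mod_cast Nat.sub_le _ _]
    · rw [Nat.sub_add_cancel hJ, hJη]

/-- The error of interpolation by periodic cubic splines. -/
theorem IsPeriodicCubicSpline.norm_sub_le {L : ℝ} (hL : 0 < L) {J : ℕ} (hJ : 1 ≤ J)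
    {p : ℕ → Plane} {σ f : ℝ → Plane} (hσ : IsPeriodicCubicSpline L J p σ)
    (hf : ContDiff ℝ 4 f) (hper : Function.Periodic f L)
    (hfp : ∀ j ≤ J, f (j * (L / J)) = p j) {K : ℝ}
    (hK : ∀ x ∈ Icc 0 L, ‖iteratedDeriv 4 f x‖ ≤ K) :
    ∀ x ∈ Icc 0 L, ‖f x - σ x‖ ≤ 52 * K * (L / J) ^ 4 ∧
      ‖deriv f x - deriv σ x‖ ≤ 52 * K * (L / J) ^ 3 := by
  have hJ' : (0 : ℝ) < J := by exact_mod_cast hJ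
  have hη : 0 < L / J := by positivity
  have hJη : (J : ℝ) * (L / J) = L := by field_simp
  set η := L / J with hηdef
  have hstep : ∀ j : ℕ, ((j + 1 : ℕ) : ℝ) * η - j * η = η := fun j => by push_cast; ring
  have hlt : ∀ j : ℕ, (j : ℝ) * η < (j + 1 : ℕ) * η := fun j => by linarith [hstep j]
  have hf4 : ContDiff ℝ (4 : ℕ) f := hf
  have hσ2 : ContDiff ℝ (2 : ℕ) σ := hσ.contDiff
  -- Used only for `i ≤ 2`: the third derivative of `σ` may jump at the nodes, so higher derivatives
  -- are taken cell by cell.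
  let e : ℕ → ℝ → Plane := fun i x => iteratedDeriv i f x - iteratedDeriv i σ x
  have he : ∀ i < 2, ∀ x, HasDerivAt (e i) (e (i + 1) x) x := fun i hi x =>
    (hf4.hasDerivAt_iteratedDeriv (by omega) x).sub (hσ2.hasDerivAt_iteratedDeriv hi x)
  have hper_e : ∀ i, e i L = e i 0 := fun i => by
    have h1 := hper.iteratedDeriv i 0
    have h2 := hσ.periodic.iteratedDeriv i 0
    rw [zero_add] at h1 h2
    simp only [e, h1, h2]
  have hnode : ∀ j ≤ J, e 0 (j * η) = 0 := fun j hj => by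
    have := hσ.interp j hj
    rw [← hηdef] at this
    simp [e, hfp j hj, this]
  have hsub : ∀ j < J, Icc ((j : ℝ) * η) ((j + 1 : ℕ) * η) ⊆ Icc 0 L := fun j hj =>
    Icc_subset_Icc (by positivity) (by rw [← hJη]; gcongr; exact hj)
  have hherm : ∀ j < J,
      ‖e 1 (j * η) + (η / 6) • ((2 : ℝ) • e 2 (j * η) + e 2 ((j + 1 : ℕ) * η))‖
        ≤ 4 * K * η ^ 3 ∧
      ‖e 1 ((j + 1 : ℕ) * η) - (η / 6) • (e 2 (j * η) + (2 : ℝ) • e 2 ((j + 1 : ℕ) * η))‖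
        ≤ 4 * K * η ^ 3 ∧
      ∀ x ∈ Icc ((j : ℝ) * η) ((j + 1 : ℕ) * η),
        ‖e 2 x‖ ≤ 2 * K * η ^ 2 + max ‖e 2 (j * η)‖ ‖e 2 ((j + 1 : ℕ) * η)‖ := by
    intro j hj
    obtain ⟨a₀, a₁, a₂, a₃, hcub⟩ := hσ.cubic j hj
    set a := (j : ℝ) * η
    set b := ((j + 1 : ℕ) : ℝ) * η
    have hud : UniqueDiffOn ℝ (Icc a b) := uniqueDiffOn_Icc (hlt j)
    -- Derivatives within a nondegenerate cell are unique, so the global derivatives of `σ` agree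
    -- with those of its cubic up to and including the nodes.
    have hσ1 : ∀ x ∈ Icc a b, iteratedDeriv 1 σ x = a₁ + (2 * x) • a₂ + (3 * x ^ 2) • a₃ := by
      intro x hx
      have h1 : HasDerivWithinAt σ (iteratedDeriv 1 σ x) (Icc a b) x := by
        simpa using (hσ2.hasDerivAt_iteratedDeriv (i := 0) (by norm_num) x).hasDerivWithinAt
      have h2 : HasDerivAt (fun l : ℝ => a₀ + l • a₁ + l ^ 2 • a₂ + l ^ 3 • a₃)
          (a₁ + (2 * x) • a₂ + (3 * x ^ 2) • a₃) x := by
        have := ((((hasDerivAt_id x).smul_const a₁).const_add a₀).add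
          (((hasDerivAt_id x).pow 2).smul_const a₂)).add
          (((hasDerivAt_id x).pow 3).smul_const a₃)
        refine this.congr_deriv ?_
        simp
      exact (hud x hx).eq_deriv _ h1 (h2.hasDerivWithinAt.congr hcub (hcub x hx))
    have hσ2' : ∀ x ∈ Icc a b, iteratedDeriv 2 σ x = (2 : ℝ) • a₂ + (6 * x) • a₃ := by
      intro x hx
      have h1 : HasDerivWithinAt (iteratedDeriv 1 σ) (iteratedDeriv 2 σ x) (Icc a b) x :=
        (hσ2.hasDerivAt_iteratedDeriv (i := 1) (by norm_num) x).hasDerivWithinAt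
      have h2 : HasDerivAt (fun l : ℝ => a₁ + (2 * l) • a₂ + (3 * l ^ 2) • a₃)
          ((2 : ℝ) • a₂ + (6 * x) • a₃) x := by
        have := (((((hasDerivAt_id x).const_mul 2).smul_const a₂).const_add a₁)).add
          ((((hasDerivAt_id x).pow 2).const_mul 3).smul_const a₃)
        refine this.congr_deriv ?_
        simp only [id]
        module
      exact (hud x hx).eq_deriv _ h1 (h2.hasDerivWithinAt.congr hσ1 (hσ1 x hx))
    -- The cubic has zero fourth derivative, so that of the error is that of `f`.
    have key := hermite_estimate (e := e 0) (e₁ := e 1) (e₂ := e 2)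
      (e₃ := fun x => iteratedDeriv 3 f x - (6 : ℝ) • a₃) (e₄ := iteratedDeriv 4 f) (B := K)
      (hlt j)
      (fun x _ => (he 0 (by norm_num) x).hasDerivWithinAt)
      (fun x _ => (he 1 (by norm_num) x).hasDerivWithinAt)
      (fun x hx => by
        have h2 : HasDerivAt (fun l : ℝ => (2 : ℝ) • a₂ + (6 * l) • a₃) ((6 : ℝ) • a₃) x := by
          simpa using (((hasDerivAt_id x).const_mul 6).smul_const a₃).const_add ((2 : ℝ) • a₂)
        exact (hf4.hasDerivAt_iteratedDeriv (by norm_num) x).hasDerivWithinAt.sub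
          (h2.hasDerivWithinAt.congr hσ2' (hσ2' x hx)))
      (fun x _ => ((hf4.hasDerivAt_iteratedDeriv (by norm_num) x).sub_const _).hasDerivWithinAt)
      (fun x hx => hK x (hsub j hj hx)) (hnode j hj.le) (hnode (j + 1) hj)
    rwa [hstep j] at key
  have hd : ∀ j ≤ J, ‖e 2 (j * η)‖ ≤ 48 * K * η ^ 2 / 2 := by
    refine norm_le_of_cyclic_tridiagonal hJ (fun j => e 2 (j * η)) ?_ ?_ ?_
    · simp only [hJη, Nat.cast_zero, zero_mul, hper_e]
    · exact fun j hj => norm_tridiagonal_le hη (hherm j (by omega)).2.1 (hherm (j + 1) hj).1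
    -- By periodicity node `J` is node `0`, so the last cell is the left neighbour of the first.
    · have h1 := (hherm (J - 1) (by omega)).2.1
      have h2 := (hherm 0 hJ).1
      simp only [Nat.sub_add_cancel hJ, hJη, hper_e] at h1
      simp only [Nat.cast_zero, zero_mul, zero_add] at h2 ⊢
      exact norm_tridiagonal_le hη h1 h2
  intro x hx
  obtain ⟨j, hj, hxj⟩ := exists_mem_Icc_node hL hJ hx
  -- `26 = 2 + 24`: the deviation of `e 2` from its linear interpolant plus the nodal bound `hd`.
  -- The two-point estimate doubles it to `52`.
  have hfin := norm_le_of_eq_zero_endpoints (f := e 0) (f' := e 1) (f'' := e 2)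
    (B := 26 * K * η ^ 2) (hlt j)
    (fun x _ => (he 0 (by norm_num) x).hasDerivWithinAt)
    (fun x _ => (he 1 (by norm_num) x).hasDerivWithinAt)
    (fun x hx => ((hherm j hj).2.2 x hx).trans (by
      have := max_le (hd j hj.le) (hd (j + 1) hj)
      linarith)) (hnode j hj.le) (hnode (j + 1) hj) x hxj
  rw [hstep j] at hfin
  simp only [e, iteratedDeriv_zero, iteratedDeriv_one] at hfin
  exact ⟨hfin.1.trans (le_of_eq (by ring)), hfin.2.trans (le_of_eq (by ring))⟩

/-! ### Families of maps with uniformly bounded derivatives -/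

section UniformBounds

variable {ι E F G : Type*} [NormedAddCommGroup E] [NormedSpace ℝ E]
  [NormedAddCommGroup F] [NormedSpace ℝ F] [NormedAddCommGroup G] [NormedSpace ℝ G]

/-- A family of `C^n` maps whose derivatives up to order `n` are bounded on every ball, uniformly
in the family. -/
def UniformlyBoundedCn (n : ℕ) (Φ : ι → E → F) : Prop :=
  (∀ i, ContDiff ℝ n (Φ i)) ∧
    ∀ ρ : ℝ, ∃ C : ℝ, ∀ i x, ‖x‖ ≤ ρ → ∀ j ≤ n, ‖iteratedFDeriv ℝ j (Φ i) x‖ ≤ C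

theorem norm_iteratedFDeriv_le_of_hasFDerivAt_const {f : E → F} {A : E →L[ℝ] F}
    (hf : ∀ x, HasFDerivAt f A x) {j : ℕ} (hj : 1 ≤ j) (x : E) :
    ‖iteratedFDeriv ℝ j f x‖ ≤ ‖A‖ := by
  obtain ⟨i, rfl⟩ : ∃ i, j = i + 1 := ⟨j - 1, by omega⟩
  have h : fderiv ℝ f = fun _ => A := funext fun x => (hf x).fderiv
  rw [← norm_iteratedFDeriv_fderiv, h]
  rcases Nat.eq_zero_or_pos i with rfl | hi
  · rw [norm_iteratedFDeriv_zero]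
  · rw [iteratedFDeriv_const_of_ne hi.ne']
    simp

theorem factorial_mul_mul_pow_le {C D : ℝ} (hC : 0 ≤ C) (hD : 1 ≤ D) {j n : ℕ} (hj : j ≤ n) :
    (j.factorial : ℝ) * C * D ^ j ≤ n.factorial * C * D ^ n := by
  gcongr

namespace UniformlyBoundedCn

variable {n : ℕ} {Φ Ψ : ι → E → F}

theorem id_family : UniformlyBoundedCn n (fun (_ : ι) (x : E) => x) := by
  refine ⟨fun _ => contDiff_id, fun ρ => ⟨max ρ 1, fun _ x hx j _ => ?_⟩⟩
  rcases Nat.eq_zero_or_pos j with rfl | hj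
  · rw [norm_iteratedFDeriv_zero]
    exact hx.trans (le_max_left _ _)
  · exact ((norm_iteratedFDeriv_le_of_hasFDerivAt_const (fun y => hasFDerivAt_id y) hj x).trans
      ContinuousLinearMap.norm_id_le).trans (le_max_right _ _)

theorem reindex {κ : Type*} (h : UniformlyBoundedCn n Φ) (e : κ → ι) :
    UniformlyBoundedCn n (fun i => Φ (e i)) :=
  ⟨fun i => h.1 (e i), fun ρ => (h.2 ρ).imp fun _ hC i => hC (e i)⟩

theorem add (hΦ : UniformlyBoundedCn n Φ) (hΨ : UniformlyBoundedCn n Ψ) :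
    UniformlyBoundedCn n (fun i x => Φ i x + Ψ i x) := by
  refine ⟨fun i => (hΦ.1 i).add (hΨ.1 i), fun ρ => ?_⟩
  obtain ⟨C, hC⟩ := hΦ.2 ρ
  obtain ⟨D, hD⟩ := hΨ.2 ρ
  refine ⟨C + D, fun i x hx j hj => ?_⟩
  have hj' : (j : ℕ∞ω) ≤ n := by exact_mod_cast hj
  rw [fun_iteratedFDeriv_add_apply ((hΦ.1 i).of_le hj').contDiffAt
    ((hΨ.1 i).of_le hj').contDiffAt]
  exact (norm_add_le _ _).trans (add_le_add (hC i x hx j hj) (hD i x hx j hj))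

theorem smul (hΦ : UniformlyBoundedCn n Φ) {c : ι → ℝ} {S : ℝ} (hc : ∀ i, |c i| ≤ S) :
    UniformlyBoundedCn n (fun i x => c i • Φ i x) := by
  refine ⟨fun i => (hΦ.1 i).const_smul (c i), fun ρ => ?_⟩
  obtain ⟨C, hC⟩ := hΦ.2 ρ
  refine ⟨S * C, fun i x hx j hj => ?_⟩
  have hj' : (j : ℕ∞ω) ≤ n := by exact_mod_cast hj
  rw [iteratedFDeriv_const_smul_apply' ((hΦ.1 i).of_le hj').contDiffAt, norm_smul]
  exact mul_le_mul (hc i) (hC i x hx j hj) (norm_nonneg _) ((abs_nonneg _).trans (hc i))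

theorem zero_family : UniformlyBoundedCn n (fun (_ : ι) (_ : E) => (0 : F)) := by
  refine ⟨fun _ => contDiff_const, fun ρ => ⟨0, fun i x _ j _ => ?_⟩⟩
  have h : (fun _ : E => (0 : F)) = 0 := rfl
  rw [h, iteratedFDeriv_zero]
  simp

theorem sum {κ : Type*} (s : Finset κ) {Φ : κ → ι → E → F}
    (h : ∀ k ∈ s, UniformlyBoundedCn n (Φ k)) :
    UniformlyBoundedCn n (fun i x => ∑ k ∈ s, Φ k i x) := by
  classical
  induction s using Finset.induction_on with
  | empty => simpa using zero_family
  | insert k s hk ih =>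
    simp only [Finset.sum_insert hk]
    exact (h k (Finset.mem_insert_self k s)).add
      (ih fun l hl => h l (Finset.mem_insert_of_mem hl))

/-- Pointwise bounds for the derivatives of `Φ i ∘ f`, uniform in `i` and `f`. -/
theorem exists_norm_comp_le (hΦ : UniformlyBoundedCn n Φ) (M : ℝ) :
    ∃ C : ℝ, 0 ≤ C ∧ ∀ (i : ι) (f : G → E), ContDiff ℝ n f → ∀ x,
      (∀ j ≤ n, ‖iteratedFDeriv ℝ j f x‖ ≤ M) →
      ∀ j ≤ n, ‖iteratedFDeriv ℝ j (fun y => Φ i (f y)) x‖ ≤ C := by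
  obtain ⟨C, hC⟩ := hΦ.2 M
  have hD : 1 ≤ max M 1 := le_max_right _ _
  -- The constant of the Faà di Bruno bound; `max M 1` makes its powers increase with the order.
  refine ⟨n.factorial * max C 0 * max M 1 ^ n, by positivity, fun i f hf x hM j hj => ?_⟩
  have hj' : (j : ℕ∞ω) ≤ n := by exact_mod_cast hj
  have hx : ‖f x‖ ≤ M := by simpa [norm_iteratedFDeriv_zero] using hM 0 (Nat.zero_le _)
  refine (norm_iteratedFDeriv_comp_le (hΦ.1 i) hf hj' x (C := max C 0) (D := max M 1)
    (fun l hl => (hC i _ hx l (hl.trans hj)).trans (le_max_left _ _))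
    (fun l h1l hl => ?_)).trans (factorial_mul_mul_pow_le (le_max_right _ _) hD hj)
  exact ((hM l (hl.trans hj)).trans (le_max_left _ _)).trans (le_self_pow₀ hD (by omega))

theorem comp {Θ : ι → F → G} (hΘ : UniformlyBoundedCn n Θ) (hΦ : UniformlyBoundedCn n Φ) :
    UniformlyBoundedCn n (fun i x => Θ i (Φ i x)) := by
  refine ⟨fun i => (hΘ.1 i).comp (hΦ.1 i), fun ρ => ?_⟩
  obtain ⟨M, hM⟩ := hΦ.2 ρ
  obtain ⟨C, -, hC⟩ := hΘ.exists_norm_comp_le (G := E) M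
  exact ⟨C, fun i x hx => hC i (Φ i) (hΦ.1 i) x (hM i x hx)⟩

/-- Superposition with `Φ i` is Lipschitz in `C¹` on bounded sets, uniformly in `i`. -/
theorem exists_norm_comp_sub_le (hΦ : UniformlyBoundedCn n Φ) (hn : 2 ≤ n) (ρ S : ℝ) :
    ∃ C : ℝ, 0 ≤ C ∧ ∀ (i : ι) (a b : ℝ → E) (x : ℝ), DifferentiableAt ℝ a x →
      DifferentiableAt ℝ b x → ‖a x‖ ≤ ρ → ‖b x‖ ≤ ρ → ‖deriv b x‖ ≤ S →
      ‖Φ i (a x) - Φ i (b x)‖ ≤ C * ‖a x - b x‖ ∧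
      ‖deriv (fun y => Φ i (a y)) x - deriv (fun y => Φ i (b y)) x‖ ≤
        C * (‖a x - b x‖ + ‖deriv a x - deriv b x‖) := by
  obtain ⟨C, hC⟩ := hΦ.2 ρ
  have hC' : ∀ i x, ‖x‖ ≤ ρ → ∀ j ≤ n, ‖iteratedFDeriv ℝ j (Φ i) x‖ ≤ max C 0 :=
    fun i x hx j hj => (hC i x hx j hj).trans (le_max_left _ _)
  set K := max C 0
  have hK : 0 ≤ K := le_max_right _ _
  refine ⟨K + K * max S 0, by positivity, fun i a b x ha hb hax hbx hS => ?_⟩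
  have hmem : ∀ y : E, ‖y‖ ≤ ρ → y ∈ Metric.closedBall (0 : E) ρ := fun y hy => by simpa using hy
  have hdiff : Differentiable ℝ (Φ i) :=
    (hΦ.1 i).differentiable (by exact_mod_cast (by omega : n ≠ 0))
  have hdiff' : Differentiable ℝ (fderiv ℝ (Φ i)) :=
    ((hΦ.1 i).fderiv_right (m := 1) (by exact_mod_cast hn)).differentiable one_ne_zero
  have hD1 : ∀ y : E, ‖y‖ ≤ ρ → ‖fderiv ℝ (Φ i) y‖ ≤ K := fun y hy => by
    rw [← norm_iteratedFDeriv_one]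
    exact hC' i y hy 1 (by omega)
  have hD2 : ∀ y : E, ‖y‖ ≤ ρ → ‖fderiv ℝ (fderiv ℝ (Φ i)) y‖ ≤ K := fun y hy => by
    rw [← norm_iteratedFDeriv_one, norm_iteratedFDeriv_fderiv]
    exact hC' i y hy 2 hn
  have hL1 : ‖Φ i (a x) - Φ i (b x)‖ ≤ K * ‖a x - b x‖ :=
    Convex.norm_image_sub_le_of_norm_fderiv_le (𝕜 := ℝ) (fun y _ => hdiff y)
      (fun y hy => hD1 y (by simpa using hy)) (convex_closedBall (0 : E) ρ)
      (hmem _ hbx) (hmem _ hax)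
  have hL2 : ‖fderiv ℝ (Φ i) (a x) - fderiv ℝ (Φ i) (b x)‖ ≤ K * ‖a x - b x‖ :=
    Convex.norm_image_sub_le_of_norm_fderiv_le (𝕜 := ℝ) (fun y _ => hdiff' y)
      (fun y hy => hD2 y (by simpa using hy)) (convex_closedBall (0 : E) ρ)
      (hmem _ hbx) (hmem _ hax)
  have hda : deriv (fun y => Φ i (a y)) x = fderiv ℝ (Φ i) (a x) (deriv a x) :=
    ((hdiff (a x)).hasFDerivAt.comp_hasDerivAt x ha.hasDerivAt).deriv
  have hdb : deriv (fun y => Φ i (b y)) x = fderiv ℝ (Φ i) (b x) (deriv b x) :=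
    ((hdiff (b x)).hasFDerivAt.comp_hasDerivAt x hb.hasDerivAt).deriv
  have hS0 : ‖deriv b x‖ ≤ max S 0 := hS.trans (le_max_left _ _)
  have hKS : 0 ≤ K * max S 0 := by positivity
  have h0 := norm_nonneg (a x - b x)
  have h1 := norm_nonneg (deriv a x - deriv b x)
  refine ⟨hL1.trans (by nlinarith), ?_⟩
  -- With this splitting the difference of the differentials acts on `deriv b x`, so no bound on
  -- `deriv a x` is needed.
  have hsplit : fderiv ℝ (Φ i) (a x) (deriv a x) - fderiv ℝ (Φ i) (b x) (deriv b x) =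
      fderiv ℝ (Φ i) (a x) (deriv a x - deriv b x) +
        (fderiv ℝ (Φ i) (a x) - fderiv ℝ (Φ i) (b x)) (deriv b x) := by
    simp
  rw [hda, hdb, hsplit]
  have h2 := ContinuousLinearMap.le_of_opNorm_le _ (hD1 _ hax) (deriv a x - deriv b x)
  have h3 := ContinuousLinearMap.le_of_opNorm_le _ hL2 (deriv b x)
  have h4 : K * ‖a x - b x‖ * ‖deriv b x‖ ≤ K * ‖a x - b x‖ * max S 0 := by gcongr
  refine (norm_add_le _ _).trans ?_
  nlinarith [mul_nonneg hK h0, mul_nonneg hKS h1]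

end UniformlyBoundedCn

/-- The time slices of a velocity field of class `C^n` on `E × [0, T]`. -/
theorem ContDiffOn.uniformlyBoundedCn_slice [ProperSpace E] {n : ℕ} {T : ℝ} (hT : 0 < T)
    {w : E → ℝ → F}
    (hw : ContDiffOn ℝ n (fun z : E × ℝ => w z.1 z.2) (univ ×ˢ Icc 0 T)) :
    UniformlyBoundedCn n (fun (t : Icc (0 : ℝ) T) (x : E) => w x t) := by
  set W : E × ℝ → F := fun z => w z.1 z.2
  set s : Set (E × ℝ) := univ ×ˢ Icc 0 T
  have hs : UniqueDiffOn ℝ s := uniqueDiffOn_univ.prod (uniqueDiffOn_Icc hT)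
  have hin : ∀ t : ℝ, ContDiff ℝ n (fun x : E => (x, t)) := fun t =>
    contDiff_id.prodMk contDiff_const
  have hmaps : ∀ t : Icc (0 : ℝ) T, MapsTo (fun x : E => (x, (t : ℝ))) univ s :=
    fun t x _ => ⟨mem_univ _, t.2⟩
  refine ⟨fun t => hw.comp_contDiff (hin t) fun x => hmaps t (mem_univ x), fun ρ => ?_⟩
  -- Compactness of ball times `[0, T]` gives uniformity in time. Composing with `x ↦ (x, t)`, whose
  -- differential has norm at most one, then turns derivatives within the slab into spatial ones.
  have hbound : ∀ j ≤ n, ∃ C, ∀ z ∈ Metric.closedBall (0 : E) ρ ×ˢ Icc (0 : ℝ) T,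
      ‖iteratedFDerivWithin ℝ j W s z‖ ≤ C := fun j hj =>
    ((isCompact_closedBall (0 : E) ρ).prod isCompact_Icc).exists_bound_of_continuousOn
      ((hw.continuousOn_iteratedFDerivWithin (by exact_mod_cast hj) hs).mono
        (prod_mono_left (subset_univ _)))
  choose! C hC using hbound
  have hC0 : ∀ j ≤ n, C j ≤ ∑ l ∈ Finset.range (n + 1), |C l| := fun j hj =>
    (le_abs_self _).trans (Finset.single_le_sum (f := fun l => |C l|) (fun _ _ => abs_nonneg _)
      (Finset.mem_range.2 (by omega)))
  set K := ∑ l ∈ Finset.range (n + 1), |C l|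
  have hK : 0 ≤ K := Finset.sum_nonneg fun _ _ => abs_nonneg _
  refine ⟨n.factorial * K * 1 ^ n, fun t x hx j hj => ?_⟩
  have hj' : (j : ℕ∞ω) ≤ n := by exact_mod_cast hj
  have hfd : ∀ y : E, HasFDerivAt (fun x : E => (x, (t : ℝ))) (ContinuousLinearMap.inl ℝ E ℝ) y :=
    fun y => hasFDerivAt_prodMk_left y (t : ℝ)
  have key := norm_iteratedFDerivWithin_comp_le hw (hin t).contDiffOn hj' hs uniqueDiffOn_univ
    (hmaps t) (mem_univ x) (C := K) (D := 1)
    (fun l hl => (hC l (hl.trans hj) (x, (t : ℝ)) ⟨by simpa using hx, t.2⟩).trans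
      (hC0 l (hl.trans hj)))
    (fun l h1l _ => by
      rw [iteratedFDerivWithin_univ, one_pow]
      exact (norm_iteratedFDeriv_le_of_hasFDerivAt_const hfd h1l x).trans
        (ContinuousLinearMap.norm_inl_le_one ℝ E ℝ))
  rw [iteratedFDerivWithin_univ] at key
  exact key.trans (factorial_mul_mul_pow_le hK le_rfl hj)

end UniformBounds

/-! ### Uniform smoothness of the Runge-Kutta step -/

namespace ExplicitRK

/-- The pairs `(t, τ)` of a time and a step size with `[t, t + τ] ⊆ [0, T]`. -/
abbrev TimeStep (T : ℝ) : Type := {p : ℝ × ℝ // 0 ≤ p.1 ∧ 0 ≤ p.2 ∧ p.1 + p.2 ≤ T}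

variable {E : Type*} [NormedAddCommGroup E] [NormedSpace ℝ E]

/-- The increment function of the scheme: `step = x + τ • increment`. -/
noncomputable def increment (R : ExplicitRK) (w : E → ℝ → E) (t τ : ℝ) (x : E) : E :=
  ∑ i ∈ Finset.range R.stages, R.b i • w (R.stage w t τ x i) (t + R.c i * τ)

variable [ProperSpace E] {n : ℕ} {T : ℝ} {w : E → ℝ → E}

/-- The condition `c i ∈ [0, 1]` keeps the stage times inside `[0, T]`, where the velocity is
controlled. -/
theorem uniformlyBoundedCn_slice (R : ExplicitRK) (hT : 0 < T)
    (hw : ContDiffOn ℝ n (fun z : E × ℝ => w z.1 z.2) (univ ×ˢ Icc 0 T))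
    {i : ℕ} (hc : R.c i ∈ Icc (0 : ℝ) 1) :
    UniformlyBoundedCn n (fun (p : TimeStep T) x => w x (p.1.1 + R.c i * p.1.2)) :=
  (hw.uniformlyBoundedCn_slice hT).reindex fun p : TimeStep T =>
    ⟨p.1.1 + R.c i * p.1.2, by
      obtain ⟨⟨t, τ⟩, ht, hτ, htτ⟩ := p
      simp only at ht hτ htτ
      exact ⟨by nlinarith [mul_nonneg hc.1 hτ], by nlinarith [mul_le_mul_of_nonneg_right hc.2 hτ]⟩⟩

/-- Explicitness permits strong induction: a stage is built by sums and compositions from earlier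
stages only, with step sizes at most `T`. -/
theorem uniformlyBoundedCn_stage (R : ExplicitRK) (hT : 0 < T)
    (hw : ContDiffOn ℝ n (fun z : E × ℝ => w z.1 z.2) (univ ×ˢ Icc 0 T))
    (hc : ∀ i < R.stages, R.c i ∈ Icc (0 : ℝ) 1) (i : ℕ) (hi : i < R.stages) :
    UniformlyBoundedCn n (fun (p : TimeStep T) x => R.stage w p.1.1 p.1.2 x i) := by
  induction i using Nat.strong_induction_on with
  | _ i ih =>
    have hrec : (fun (p : TimeStep T) x => R.stage w p.1.1 p.1.2 x i) =
        fun (p : TimeStep T) x => x + p.1.2 • ∑ j : Fin i,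
          R.a i j • w (R.stage w p.1.1 p.1.2 x j) (p.1.1 + R.c j * p.1.2) := by
      funext p x
      rw [stage]
    rw [hrec]
    refine UniformlyBoundedCn.id_family.add (UniformlyBoundedCn.smul (S := T) ?_ fun p => ?_)
    · refine UniformlyBoundedCn.sum _ fun j _ => UniformlyBoundedCn.smul ?_ fun _ => le_rfl
      exact (R.uniformlyBoundedCn_slice hT hw (hc j (j.2.trans hi))).comp
        (ih j j.2 (j.2.trans hi))
    · rw [abs_of_nonneg p.2.2.1]
      linarith [p.2.1, p.2.2.2]

theorem uniformlyBoundedCn_increment (R : ExplicitRK) (hT : 0 < T)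
    (hw : ContDiffOn ℝ n (fun z : E × ℝ => w z.1 z.2) (univ ×ˢ Icc 0 T))
    (hc : ∀ i < R.stages, R.c i ∈ Icc (0 : ℝ) 1) :
    UniformlyBoundedCn n (fun (p : TimeStep T) x => R.increment w p.1.1 p.1.2 x) :=
  UniformlyBoundedCn.sum _ fun i hi => UniformlyBoundedCn.smul
    ((R.uniformlyBoundedCn_slice hT hw (hc i (Finset.mem_range.1 hi))).comp
      (R.uniformlyBoundedCn_stage hT hw hc i (Finset.mem_range.1 hi))) fun _ => le_rfl

theorem uniformlyBoundedCn_step (R : ExplicitRK) (hT : 0 < T)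
    (hw : ContDiffOn ℝ n (fun z : E × ℝ => w z.1 z.2) (univ ×ˢ Icc 0 T))
    (hc : ∀ i < R.stages, R.c i ∈ Icc (0 : ℝ) 1) :
    UniformlyBoundedCn n (fun (p : TimeStep T) x => R.step w p.1.1 p.1.2 x) :=
  UniformlyBoundedCn.id_family.add ((R.uniformlyBoundedCn_increment hT hw hc).smul (S := T)
    fun p => by rw [abs_of_nonneg p.2.2.1]; linarith [p.2.1, p.2.2.2])

end ExplicitRK

/-! ### One step of the tracking algorithm -/

/-- Linearity of spline interpolation, which lets the marker increments, and hence their factor `τ`,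
be interpolated on their own. -/
theorem IsPeriodicCubicSpline.sub {L : ℝ} {J : ℕ} {p p' : ℕ → Plane} {σ σ' : ℝ → Plane}
    (h : IsPeriodicCubicSpline L J p σ) (h' : IsPeriodicCubicSpline L J p' σ') :
    IsPeriodicCubicSpline L J (fun j => p j - p' j) (fun l => σ l - σ' l) where
  periodic := fun x => by simp only [h.periodic x, h'.periodic x]
  contDiff := h.contDiff.sub h'.contDiff
  cubic := fun j hj => by
    obtain ⟨a₀, a₁, a₂, a₃, ha⟩ := h.cubic j hj
    obtain ⟨b₀, b₁, b₂, b₃, hb⟩ := h'.cubic j hj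
    refine ⟨a₀ - b₀, a₁ - b₁, a₂ - b₂, a₃ - b₃, fun l hl => ?_⟩
    rw [ha l hl, hb l hl]
    module
  interp := fun j hj => by rw [h.interp j hj, h'.interp j hj]

/-- The error of one step of the tracking algorithm, for a step map `id + τ • Φ i`. -/
theorem UniformlyBoundedCn.exists_norm_spline_step_sub_le {ι : Type*} {Φ : ι → Plane → Plane}
    (hΦ : UniformlyBoundedCn 4 Φ) {L : ℝ} (hL : 0 < L) (M : ℝ) :
    ∃ C : ℝ, 0 ≤ C ∧ ∀ (i : ι) (τ : ℝ), 0 ≤ τ → ∀ J : ℕ, 1 ≤ J →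
      ∀ g : ℝ → Plane, ContDiff ℝ 4 g → Function.Periodic g L →
      (∀ j ≤ 4, ∀ x ∈ Icc 0 L, ‖iteratedDeriv j g x‖ ≤ M) →
      ∀ (p p' : ℕ → Plane) (σ σ' : ℝ → Plane),
      IsPeriodicCubicSpline L J p σ → IsPeriodicCubicSpline L J p' σ' →
      (∀ j ≤ J, g (j * (L / J)) = p j) → (∀ j ≤ J, p' j = p j + τ • Φ i (p j)) →
      ∀ x ∈ Icc 0 L, ‖σ' x - (σ x + τ • Φ i (σ x))‖ ≤ C * (τ * (L / J) ^ 4) ∧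
        ‖deriv σ' x - deriv (fun l => σ l + τ • Φ i (σ l)) x‖ ≤ C * (τ * (L / J) ^ 3) := by
  obtain ⟨A, hA0, hA⟩ := hΦ.exists_norm_comp_le (G := ℝ) M
  -- The radius covers both `g` and `σ`: `‖g‖ ≤ M`, and the interpolation error is at most `52 * M *
  -- L ^ 4` since `η ≤ L`.
  obtain ⟨B, hB0, hB⟩ := hΦ.exists_norm_comp_sub_le (by norm_num) (M + 52 * M * L ^ 4) M
  -- First term: interpolation of the increment. Second: replacing `g` by `σ` inside `Φ`, where `L +
  -- 1` comes from `η ^ 4 + η ^ 3 ≤ (L + 1) η ^ 3`. The sign of `M` is not yet known here.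
  refine ⟨52 * A + B * (52 * |M| * (L + 1)), by positivity, ?_⟩
  intro i τ hτ J hJ g hg hgper hgM p p' σ σ' hσ hσ' hgp hpp x hx
  have hJ' : (0 : ℝ) < J := by exact_mod_cast hJ
  have hη : 0 < L / J := by positivity
  have hηL : L / J ≤ L := div_le_self hL.le (by exact_mod_cast hJ)
  have hM0 : 0 ≤ M := (norm_nonneg _).trans (hgM 0 (by norm_num) x hx)
  rw [abs_of_nonneg hM0]
  have hΦdiff : Differentiable ℝ (Φ i) := (hΦ.1 i).differentiable (by norm_num)
  have hgdiff : Differentiable ℝ g := hg.differentiable (by norm_num)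
  have hσdiff : Differentiable ℝ σ := hσ.contDiff.differentiable (by norm_num)
  have hσdiff' : Differentiable ℝ σ' := hσ'.contDiff.differentiable (by norm_num)
  have hΦg : ContDiff ℝ 4 (fun l => Φ i (g l)) := (hΦ.1 i).comp hg
  -- The gain of `τ`: `σ' - σ` interpolates `τ • Φ i ∘ g`, whose fourth derivative is at most `τ *
  -- A`.
  have hspline := (hσ'.sub hσ).norm_sub_le hL hJ (f := fun l => τ • Φ i (g l)) (K := τ * A)
    (hΦg.const_smul τ) (fun y => by simp only [hgper y])
    (fun j hj => by rw [hgp j hj, hpp j hj, add_sub_cancel_left])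
    (fun y hy => by
      rw [← norm_iteratedFDeriv_eq_norm_iteratedDeriv,
        iteratedFDeriv_const_smul_apply' (hΦg.contDiffAt), norm_smul, Real.norm_of_nonneg hτ]
      gcongr
      exact hA i g hg y (fun j hj => by
        rw [norm_iteratedFDeriv_eq_norm_iteratedDeriv]
        exact hgM j hj y hy) 4 le_rfl) x hx
  have hgσ := hσ.norm_sub_le hL hJ hg hgper hgp (hgM 4 le_rfl) x hx
  have hgx : ‖g x‖ ≤ M := by simpa using hgM 0 (by norm_num) x hx
  have hg'x : ‖deriv g x‖ ≤ M := by simpa using hgM 1 (by norm_num) x hx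
  have hη4 : (L / J) ^ 4 ≤ L ^ 4 := by gcongr
  have hσx : ‖σ x‖ ≤ M + 52 * M * L ^ 4 := by
    have h1 : ‖σ x‖ ≤ ‖g x‖ + ‖g x - σ x‖ := by
      have := norm_sub_le (g x) (g x - σ x)
      rwa [sub_sub_cancel] at this
    have h2 : 52 * M * (L / J) ^ 4 ≤ 52 * M * L ^ 4 := by gcongr
    linarith [hgσ.1]
  have hlip := hB i σ g x (hσdiff x) (hgdiff x) hσx
    (hgx.trans (le_add_of_nonneg_right (by positivity))) hg'x
  rw [norm_sub_rev (σ x) (g x), norm_sub_rev (deriv σ x)] at hlip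
  set η := L / J
  have hd1 : deriv (fun l => τ • Φ i (g l)) x = τ • deriv (fun l => Φ i (g l)) x :=
    deriv_fun_const_smul τ ((hΦdiff _).comp x (hgdiff x))
  have hd2 : deriv (fun l => σ l + τ • Φ i (σ l)) x =
      deriv σ x + τ • deriv (fun l => Φ i (σ l)) x := by
    have hΦσ : DifferentiableAt ℝ (fun l => Φ i (σ l)) x := (hΦdiff _).comp x (hσdiff x)
    exact ((hσdiff x).hasDerivAt.add (hΦσ.hasDerivAt.const_smul τ)).deriv
  have hd3 : deriv (fun l => σ' l - σ l) x = deriv σ' x - deriv σ x :=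
    deriv_fun_sub (hσdiff' x) (hσdiff x)
  have hη3 : 0 ≤ τ * η ^ 3 := by positivity
  have hη4' : 0 ≤ τ * η ^ 4 := by positivity
  constructor
  · have h : σ' x - (σ x + τ • Φ i (σ x)) =
        -(τ • Φ i (g x) - (σ' x - σ x)) - τ • (Φ i (σ x) - Φ i (g x)) := by
      rw [smul_sub]; abel
    rw [h]
    refine (norm_sub_le _ _).trans ?_
    rw [norm_neg, norm_smul, Real.norm_of_nonneg hτ]
    have h2 : ‖Φ i (σ x) - Φ i (g x)‖ ≤ B * (52 * M * η ^ 4) :=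
      hlip.1.trans (by gcongr; exact hgσ.1)
    have h3 : τ * ‖Φ i (σ x) - Φ i (g x)‖ ≤ τ * (B * (52 * M * η ^ 4)) := by gcongr
    have h4 : 0 ≤ B * (52 * M * L) * (τ * η ^ 4) := by positivity
    linarith [hspline.1]
  · have h : deriv σ' x - (deriv σ x + τ • deriv (fun l => Φ i (σ l)) x) =
        -(τ • deriv (fun l => Φ i (g l)) x - (deriv σ' x - deriv σ x)) -
          τ • (deriv (fun l => Φ i (σ l)) x - deriv (fun l => Φ i (g l)) x) := by
      rw [smul_sub]; abel
    rw [hd2, h]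
    refine (norm_sub_le _ _).trans ?_
    rw [norm_neg, norm_smul, Real.norm_of_nonneg hτ]
    have h2 : ‖deriv (fun l => Φ i (σ l)) x - deriv (fun l => Φ i (g l)) x‖ ≤
        B * (52 * M * η ^ 3 * (L + 1)) := by
      refine hlip.2.trans ?_
      gcongr
      have h5 : 52 * M * η ^ 4 ≤ 52 * M * η ^ 3 * L := by
        rw [pow_succ, ← mul_assoc]; gcongr
      linarith [hgσ.1, hgσ.2]
    have h3 : τ * ‖deriv (fun l => Φ i (σ l)) x - deriv (fun l => Φ i (g l)) x‖ ≤
        τ * (B * (52 * M * η ^ 3 * (L + 1))) := by gcongr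
    have h4 := hspline.2
    rw [hd1, hd3] at h4
    linarith

/-! ### Pointwise bounds and `crNorm` -/

theorem norm_iteratedDeriv_le_of_crNorm_le {r : ℕ} {L : ℝ} (hL : 0 < L) {f : ℝ → Plane}
    (hf : ContDiff ℝ r f) {M : ℝ≥0} (h : crNorm r L f ≤ M) {j : ℕ} (hj : j ≤ r) {x : ℝ}
    (hx : x ∈ Icc 0 L) : ‖iteratedDeriv j f x‖ ≤ M := by
  rw [crNorm, if_pos hf.contDiffOn] at h
  have h1 : ‖iteratedDerivWithin j f (Icc 0 L) x‖ₑ ≤ M :=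
    ((le_iSup₂ (f := fun l (_ : l ∈ Icc 0 L) => ‖iteratedDerivWithin j f (Icc 0 L) l‖ₑ) x hx).trans
      (Finset.single_le_sum
        (f := fun j => ⨆ l ∈ Icc 0 L, ‖iteratedDerivWithin j f (Icc 0 L) l‖ₑ)
        (fun _ _ => zero_le) (Finset.mem_range.2 (by omega)))).trans h
  rw [iteratedDerivWithin_eq_iteratedDeriv (uniqueDiffOn_Icc hL)
    ((hf.of_le (by exact_mod_cast hj)).contDiffAt) hx, enorm_le_coe] at h1
  exact_mod_cast h1

theorem iSup_enorm_le_ofReal {s : Set ℝ} {f : ℝ → Plane} {A : ℝ} (h : ∀ x ∈ s, ‖f x‖ ≤ A) :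
    ⨆ x ∈ s, ‖f x‖ₑ ≤ ENNReal.ofReal A :=
  iSup₂_le fun x hx => by
    rw [← ofReal_norm]
    exact ENNReal.ofReal_le_ofReal (h x hx)

theorem crNorm_zero_le {L : ℝ} {f : ℝ → Plane} (hf : Continuous f) {A : ℝ}
    (h : ∀ x ∈ Icc 0 L, ‖f x‖ ≤ A) : crNorm 0 L f ≤ ENNReal.ofReal A := by
  rw [crNorm, if_pos (by exact_mod_cast contDiffOn_zero.2 hf.continuousOn)]
  simpa using iSup_enorm_le_ofReal h

theorem crNorm_one_le {L : ℝ} (hL : 0 < L) {f : ℝ → Plane} (hf : ContDiff ℝ 1 f) {A B : ℝ}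
    (h : ∀ x ∈ Icc 0 L, ‖f x‖ ≤ A) (h' : ∀ x ∈ Icc 0 L, ‖deriv f x‖ ≤ B) :
    crNorm 1 L f ≤ ENNReal.ofReal (A + B) := by
  have h0 : (0 : ℝ) ∈ Icc 0 L := left_mem_Icc.2 hL.le
  rw [crNorm, if_pos (by exact_mod_cast hf.contDiffOn), Finset.sum_range_succ,
    Finset.sum_range_one, ENNReal.ofReal_add ((norm_nonneg _).trans (h 0 h0))
      ((norm_nonneg _).trans (h' 0 h0))]
  refine add_le_add (by simpa using iSup_enorm_le_ofReal h) ?_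
  refine iSup_enorm_le_ofReal fun x hx => ?_
  rw [iteratedDerivWithin_one, ((hf.differentiable one_ne_zero) x).derivWithin
    (uniqueDiffOn_Icc hL x hx)]
  exact h' x hx

/-! ### Multi-step maps and accumulation of the error -/

theorem multiStep_self (F : ℕ → Plane → Plane) (m : ℕ) : multiStep F m m = id := by
  simp [multiStep, compSteps]

theorem multiStep_succ (F : ℕ → Plane → Plane) {m n : ℕ} (h : m ≤ n) (x : Plane) :
    multiStep F m (n + 1) x = F n (multiStep F m n x) := by
  have h1 : n + 1 - m = (n - m) + 1 := by omega
  have h2 : m + (n - m) = n := by omega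
  simp [multiStep, h1, compSteps, h2]

/-- The time step from level `n` to level `n + 1` of the grid with `N` steps. -/
noncomputable def gridStep {T : ℝ} (hT : 0 < T) {N n : ℕ} (hn : n + 1 ≤ N) :
    ExplicitRK.TimeStep T :=
  ⟨(n * (T / N), T / N), by positivity, by positivity, by
    have hN : (0 : ℝ) < N := by exact_mod_cast (by omega : 0 < N)
    have h1 : ((n : ℝ) + 1) ≤ N := by exact_mod_cast hn
    calc (n : ℝ) * (T / N) + T / N = (n + 1) * (T / N) := by ring
      _ ≤ N * (T / N) := by gcongr
      _ = T := by field_simp⟩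

section Tracking

variable {k r : ℕ} {T : ℝ} {w : Plane → ℝ → Plane} {R : ExplicitRK}

theorem contDiff_rkStep (hT : 0 < T)
    (hw : ContDiffOn ℝ r (fun z : Plane × ℝ => w z.1 z.2) (univ ×ˢ Icc 0 T))
    (hc : ∀ i < R.stages, R.c i ∈ Icc (0 : ℝ) 1) {N n : ℕ} (hn : n + 1 ≤ N) :
    ContDiff ℝ r (rkStep R w T N n) :=
  (R.uniformlyBoundedCn_step hT hw hc).1 (gridStep hT hn)

theorem contDiff_rkMap (hT : 0 < T)
    (hw : ContDiffOn ℝ r (fun z : Plane × ℝ => w z.1 z.2) (univ ×ˢ Icc 0 T))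
    (hc : ∀ i < R.stages, R.c i ∈ Icc (0 : ℝ) 1) {N m n : ℕ} (hmn : m ≤ n) (hn : n ≤ N) :
    ContDiff ℝ r (rkMap R w T N m n) := by
  induction n, hmn using Nat.le_induction with
  | base => rw [rkMap, multiStep_self]; exact contDiff_id
  | succ n hmn ih =>
    have h : rkMap R w T N m (n + 1) = rkStep R w T N n ∘ rkMap R w T N m n :=
      funext fun x => multiStep_succ _ hmn x
    rw [h]
    exact (contDiff_rkStep hT hw hc hn).comp (ih (by omega))

/-- Identifies each tracked boundary as the spline interpolant of the Runge-Kutta image of `χ₀`, a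
curve that `BoundedBoundaries` controls. -/
theorem marker_eq_rkMap {N J : ℕ} {L : ℝ} {χ₀ : ℝ → Plane} (n j : ℕ) :
    rkMap R w T N 0 n (χ₀ (j * (L / J))) = marker R w T N L J χ₀ n j := by
  induction n with
  | zero => simp [rkMap, multiStep_self, marker]
  | succ n ih => rw [rkMap, multiStep_succ _ (Nat.zero_le n), marker, ← ih]; rfl

/-- The tracked boundary differs from the Runge-Kutta image of the preceding one by
`O(τ η ^ 4)`, and its derivative by `O(τ η ^ 3)`; moreover it stays bounded in `C¹`. -/
theorem exists_tracking_step_le (hr : 4 ≤ r) (hT : 0 < T)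
    (hw : ContDiffOn ℝ r (fun z : Plane × ℝ => w z.1 z.2) (univ ×ˢ Icc 0 T))
    (hc : ∀ i < R.stages, R.c i ∈ Icc (0 : ℝ) 1) {L : ℝ} (hL : 0 < L) (M : ℝ≥0) :
    ∃ C : ℝ, 0 ≤ C ∧ ∀ (N J : ℕ), 1 ≤ J →
      ∀ χ₀ : ℝ → Plane, ContDiff ℝ r χ₀ → Function.Periodic χ₀ L →
        BoundedBoundaries r R w T N L χ₀ M →
      ∀ χ : ℕ → ℝ → Plane, IsTrackedBoundary R w T N L J χ₀ χ →
      (∀ n ≤ N, ∀ x ∈ Icc 0 L, ‖χ n x‖ ≤ C ∧ ‖deriv (χ n) x‖ ≤ C) ∧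
      ∀ n, n + 1 ≤ N → ∀ x ∈ Icc 0 L,
        ‖χ (n + 1) x - rkStep R w T N n (χ n x)‖ ≤ C * (T / N * (L / J) ^ 4) ∧
        ‖deriv (χ (n + 1)) x - deriv (fun l => rkStep R w T N n (χ n l)) x‖ ≤
          C * (T / N * (L / J) ^ 3) := by
  have hw4 : ContDiffOn ℝ (4 : ℕ) (fun z : Plane × ℝ => w z.1 z.2) (univ ×ˢ Icc 0 T) :=
    hw.of_le (by exact_mod_cast hr)
  obtain ⟨A, hA0, hA⟩ :=
    (R.uniformlyBoundedCn_increment hT hw4 hc).exists_norm_spline_step_sub_le hL M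
  refine ⟨A + (M + 52 * M * (L ^ 4 + L ^ 3)), by positivity, ?_⟩
  intro N J hJ χ₀ hχ₀ hper hM χ hχ
  have hg : ∀ n ≤ N, ContDiff ℝ r (rkMap R w T N 0 n ∘ χ₀) := fun n hn =>
    (contDiff_rkMap hT hw hc (Nat.zero_le n) hn).comp hχ₀
  have hg4 : ∀ n ≤ N, ContDiff ℝ 4 (rkMap R w T N 0 n ∘ χ₀) := fun n hn =>
    (hg n hn).of_le (by exact_mod_cast hr)
  have hgper : ∀ n, Function.Periodic (rkMap R w T N 0 n ∘ χ₀) L := fun n => hper.comp _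
  have hgM : ∀ n ≤ N, ∀ j ≤ 4, ∀ x ∈ Icc 0 L,
      ‖iteratedDeriv j (rkMap R w T N 0 n ∘ χ₀) x‖ ≤ M := fun n hn j hj x hx =>
    norm_iteratedDeriv_le_of_crNorm_le hL (hg n hn) (le_add_self.trans (hM n hn))
      (hj.trans hr) hx
  have hJ' : (0 : ℝ) < J := by exact_mod_cast hJ
  have hη : 0 < L / J := by positivity
  have hηL : L / J ≤ L := div_le_self hL.le (by exact_mod_cast hJ)
  refine ⟨fun n hn x hx => ?_, fun n hn x hx => ?_⟩
  · have h := (hχ n hn).norm_sub_le hL hJ (hg4 n hn) (hgper n)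
      (fun j _ => marker_eq_rkMap n j) (hgM n hn 4 le_rfl) x hx
    set g := rkMap R w T N 0 n ∘ χ₀
    have h0 : ‖g x‖ ≤ M := by simpa [g] using hgM n hn 0 (by norm_num) x hx
    have h1 : ‖deriv g x‖ ≤ M := by simpa using hgM n hn 1 (by norm_num) x hx
    have h2 := norm_sub_le (g x) (g x - χ n x)
    have h3 := norm_sub_le (deriv g x) (deriv g x - deriv (χ n) x)
    rw [sub_sub_cancel] at h2 h3
    have h4 : 52 * (M : ℝ) * (L / J) ^ 4 ≤ 52 * M * L ^ 4 := by gcongr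
    have h5 : 52 * (M : ℝ) * (L / J) ^ 3 ≤ 52 * M * L ^ 3 := by gcongr
    have h6 : 0 ≤ 52 * (M : ℝ) * L ^ 4 := by positivity
    have h7 : 0 ≤ 52 * (M : ℝ) * L ^ 3 := by positivity
    constructor <;> linarith [h.1, h.2]
  · have h := hA (gridStep hT hn) (T / N) (by positivity) J hJ _ (hg4 n (by omega)) (hgper n)
      (hgM n (by omega)) _ _ _ _ (hχ n (by omega)) (hχ (n + 1) hn)
      (fun j _ => marker_eq_rkMap n j) (fun j _ => rfl) x hx
    have hle : A ≤ A + (M + 52 * M * (L ^ 4 + L ^ 3)) := le_add_of_nonneg_right (by positivity)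
    exact ⟨h.1.trans (mul_le_mul_of_nonneg_right hle (by positivity)),
      h.2.trans (mul_le_mul_of_nonneg_right hle (by positivity))⟩

/-- The error accumulated over `i` steps. Both sides of the comparison use the same Runge-Kutta map,
so only its smoothness enters and neither its order nor the exact flow. -/
theorem exists_tracking_error_le (hr : 4 ≤ r) (hT : 0 < T)
    (hw : ContDiffOn ℝ r (fun z : Plane × ℝ => w z.1 z.2) (univ ×ˢ Icc 0 T))
    (hc : ∀ i < R.stages, R.c i ∈ Icc (0 : ℝ) 1) {L : ℝ} (hL : 0 < L) (M : ℝ≥0) (i : ℕ) :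
    ∃ C : ℝ, 0 ≤ C ∧ ∀ (N J : ℕ), 1 ≤ N → 1 ≤ J →
      ∀ χ₀ : ℝ → Plane, ContDiff ℝ r χ₀ → Function.Periodic χ₀ L →
        BoundedBoundaries r R w T N L χ₀ M →
      ∀ χ : ℕ → ℝ → Plane, IsTrackedBoundary R w T N L J χ₀ χ →
      ∀ m, m + i ≤ N → ∀ x ∈ Icc 0 L,
        ‖χ (m + i) x - rkMap R w T N m (m + i) (χ m x)‖ ≤ C * (T / N * (L / J) ^ 4) ∧
        ‖deriv (χ (m + i)) x - deriv (fun l => rkMap R w T N m (m + i) (χ m l)) x‖ ≤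
          C * (T / N * (L / J) ^ 3) := by
  induction i with
  | zero =>
    refine ⟨0, le_rfl, fun N J _ _ χ₀ _ _ _ χ _ m _ x _ => ?_⟩
    simp [rkMap, multiStep_self]
  | succ i ih =>
    obtain ⟨A, hA0, hA⟩ := ih
    obtain ⟨B, hB0, hB⟩ := exists_tracking_step_le hr hT hw hc hL M
    -- The radius covers the tracked boundary (`B`) and, by the induction hypothesis, the composed
    -- image (`B` plus the error). Only the tracked boundary needs a derivative bound, again `B`.
    obtain ⟨D, hD0, hD⟩ := (R.uniformlyBoundedCn_step hT hw hc).exists_norm_comp_sub_le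
      (by omega) (B + A * (T * L ^ 4)) B
    refine ⟨B + D * (A * (L + 1)), by positivity, ?_⟩
    intro N J hN hJ χ₀ hχ₀ hper hM χ hχ m hm x hx
    obtain ⟨hbd, hstep⟩ := hB N J hJ χ₀ hχ₀ hper hM χ hχ
    have hA' := hA N J hN hJ χ₀ hχ₀ hper hM χ hχ m (by omega) x hx
    have hs := hstep (m + i) hm x hx
    obtain ⟨hb, hb'⟩ := hbd (m + i) (by omega) x hx
    have hJ' : (0 : ℝ) < J := by exact_mod_cast hJ
    have hη : 0 < L / J := by positivity
    have hηL : L / J ≤ L := div_le_self hL.le (by exact_mod_cast hJ)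
    have hτT : T / N ≤ T := div_le_self hT.le (by exact_mod_cast hN)
    have hτ : 0 ≤ T / N := by positivity
    have hdχ : ∀ n ≤ N, Differentiable ℝ (χ n) := fun n hn =>
      (hχ n hn).contDiff.differentiable (by norm_num)
    have hr0 : (r : ℕ∞ω) ≠ 0 := by exact_mod_cast (by omega : r ≠ 0)
    have hda : Differentiable ℝ (fun l => rkMap R w T N m (m + i) (χ m l)) :=
      ((contDiff_rkMap hT hw hc (Nat.le_add_right m i) (by omega)).differentiable hr0).comp
        (hdχ m (by omega))
    have hsucc : ∀ l, rkMap R w T N m (m + (i + 1)) (χ m l) =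
        rkStep R w T N (m + i) (rkMap R w T N m (m + i) (χ m l)) := fun l =>
      multiStep_succ _ (Nat.le_add_right m i) _
    simp only [hsucc]
    have hbound : A * (T / N * (L / J) ^ 4) ≤ A * (T * L ^ 4) := by gcongr
    have hax : ‖rkMap R w T N m (m + i) (χ m x)‖ ≤ B + A * (T * L ^ 4) := by
      have h := norm_sub_le (χ (m + i) x) (χ (m + i) x - rkMap R w T N m (m + i) (χ m x))
      rw [sub_sub_cancel] at h
      linarith [hA'.1]
    have hlip := hD (gridStep hT hm) _ (χ (m + i)) x (hda x) (hdχ (m + i) (by omega) x) hax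
      (hb.trans (le_add_of_nonneg_right (by positivity))) hb'
    rw [norm_sub_rev, norm_sub_rev (rkMap R w T N m (m + i) (χ m x)), norm_sub_rev (deriv _ _),
      norm_sub_rev (deriv (fun l => rkMap R w T N m (m + i) (χ m l)) x)] at hlip
    set η := L / J
    set τ := T / N
    have hη34 : τ * η ^ 4 ≤ τ * η ^ 3 * L := by
      rw [pow_succ, ← mul_assoc]; gcongr
    have hη4 : 0 ≤ τ * η ^ 4 := by positivity
    constructor
    · have h1 : ‖rkStep R w T N (m + i) (χ (m + i) x) -
          rkStep R w T N (m + i) (rkMap R w T N m (m + i) (χ m x))‖ ≤ D * (A * (τ * η ^ 4)) :=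
        hlip.1.trans (by gcongr; exact hA'.1)
      -- Telescoping: the fresh error of the last step plus the old error transported by that step.
      have h2 := norm_add_le (χ (m + i + 1) x - rkStep R w T N (m + i) (χ (m + i) x))
        (rkStep R w T N (m + i) (χ (m + i) x) -
          rkStep R w T N (m + i) (rkMap R w T N m (m + i) (χ m x)))
      rw [sub_add_sub_cancel] at h2
      have h3 : 0 ≤ D * (A * L) * (τ * η ^ 4) := by positivity
      refine h2.trans ?_
      linarith [hs.1]
    · have h1 : ‖deriv (fun l => rkStep R w T N (m + i) (χ (m + i) l)) x -
          deriv (fun l => rkStep R w T N (m + i) (rkMap R w T N m (m + i) (χ m l))) x‖ ≤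
            D * (A * (τ * η ^ 3 * L) + A * (τ * η ^ 3)) := by
        refine hlip.2.trans ?_
        gcongr
        · exact hA'.1.trans (by gcongr)
        · exact hA'.2
      have h2 := norm_add_le
        (deriv (χ (m + i + 1)) x - deriv (fun l => rkStep R w T N (m + i) (χ (m + i) l)) x)
        (deriv (fun l => rkStep R w T N (m + i) (χ (m + i) l)) x -
          deriv (fun l => rkStep R w T N (m + i) (rkMap R w T N m (m + i) (χ m l))) x)
      rw [sub_add_sub_cancel] at h2
      refine h2.trans ?_
      linarith [hs.2]

end Tracking

/-! ### Assembly of the estimate -/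

theorem mainTheorem3
    (k r : ℕ) (hk : 1 ≤ k) (hr : max (k + 1) 4 ≤ r)
    (T : ℝ) (hT : 0 < T)
    (w : Plane → ℝ → Plane)
    (hw : ContDiffOn ℝ r (fun z : Plane × ℝ => w z.1 z.2) (univ ×ˢ Icc 0 T))
    (hflow : HasGlobalFlow w T)
    (R : ExplicitRK) (hR : R.HasOrder k) (hc : ∀ i < R.stages, R.c i ∈ Icc (0 : ℝ) 1)
    (L : ℝ) (hL : 0 < L) (M : ℝ≥0) :
    ∃ C : ℝ, 0 < C ∧
      ∀ (N J : ℕ), 1 ≤ N → 1 ≤ J →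
      ∀ χ₀ : ℝ → Plane, ContDiff ℝ r χ₀ → Function.Periodic χ₀ L →
        BoundedBoundaries r R w T N L χ₀ M →
      ∀ χ : ℕ → ℝ → Plane, IsTrackedBoundary R w T N L J χ₀ χ →
      ∀ m n : ℕ, m ≤ n → n ≤ m + k → n ≤ N →
      ∀ μ : ℕ, μ ≤ 1 →
        crNorm μ L (fun l => χ n l - rkMap R w T N m n (χ m l)) ≤
          ENNReal.ofReal (C * ((L / J) ^ μ)⁻¹ *
            ∑ i ∈ Finset.range k,
              ((T / N) ^ (i + 1) * (L / J) ^ (min 4 (r - i)) + (T / N) ^ (k + 1))) := by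
  have hr4 : 4 ≤ r := (le_max_right _ _).trans hr
  choose A hA0 hA using exists_tracking_error_le hr4 hT hw hc hL M
  have hS0 : 0 ≤ ∑ i ∈ Finset.range (k + 1), A i := Finset.sum_nonneg fun i _ => hA0 i
  -- Summing over all step counts `0, …, k` makes the constant independent of `n - m`; `L + 1`
  -- serves the `C¹` norm, and the final `1` ensures positivity.
  refine ⟨(∑ i ∈ Finset.range (k + 1), A i) * (L + 1) + 1, by positivity, ?_⟩
  intro N J hN hJ χ₀ hχ₀ hper hM χ hχ m n hmn hnk hnN μ hμ
  obtain ⟨i, rfl⟩ := Nat.exists_eq_add_of_le hmn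
  have hAS : A i ≤ ∑ i ∈ Finset.range (k + 1), A i :=
    Finset.single_le_sum (fun i _ => hA0 i) (Finset.mem_range.2 (by omega))
  set S := ∑ i ∈ Finset.range (k + 1), A i
  have hmain := hA i N J hN hJ χ₀ hχ₀ hper hM χ hχ m hnN
  have hJ' : (0 : ℝ) < J := by exact_mod_cast hJ
  have hη : 0 < L / J := by positivity
  have hηL : L / J ≤ L := div_le_self hL.le (by exact_mod_cast hJ)
  have hτ : 0 ≤ T / N := by positivity
  -- The summand `i = 0` suffices: it is present since `k ≥ 1`, and its exponent is `min 4 r = 4`.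
  have hsum : T / N * (L / J) ^ 4 ≤ ∑ i ∈ Finset.range k,
      ((T / N) ^ (i + 1) * (L / J) ^ (min 4 (r - i)) + (T / N) ^ (k + 1)) := by
    refine le_trans ?_ (Finset.single_le_sum (fun i _ => by positivity)
      (Finset.mem_range.2 (show 0 < k by omega)))
    rw [Nat.sub_zero, min_eq_left hr4, zero_add, pow_one]
    exact le_add_of_nonneg_right (by positivity)
  set Q := ∑ i ∈ Finset.range k,
      ((T / N) ^ (i + 1) * (L / J) ^ (min 4 (r - i)) + (T / N) ^ (k + 1))
  have hχC : ∀ n ≤ N, ContDiff ℝ 1 (χ n) := fun n hn => (hχ n hn).contDiff.of_le (by norm_num)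
  have hmap : ContDiff ℝ 1 (fun l => rkMap R w T N m (m + i) (χ m l)) :=
    ((contDiff_rkMap hT hw hc hmn hnN).of_le (by exact_mod_cast (by omega : 1 ≤ r))).comp
      (hχC m (by omega))
  have herr : ContDiff ℝ 1 (fun l => χ (m + i) l - rkMap R w T N m (m + i) (χ m l)) :=
    (hχC _ hnN).sub hmap
  set τ := T / N
  set η := L / J
  have h0 : 0 ≤ τ * η ^ 4 := by positivity
  have hbound : S * (L + 1) * (τ * η ^ 4) ≤ (S * (L + 1) + 1) * Q :=
    mul_le_mul (by linarith) hsum h0 (by positivity)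
  interval_cases μ
  · refine (crNorm_zero_le herr.continuous fun x hx => (hmain x hx).1).trans
      (ENNReal.ofReal_le_ofReal ?_)
    rw [pow_zero, inv_one, mul_one]
    refine le_trans ?_ hbound
    gcongr
    nlinarith
  · refine (crNorm_one_le hL herr (fun x hx => (hmain x hx).1) fun x hx => ?_).trans
      (ENNReal.ofReal_le_ofReal (?_ : _ + A i * (τ * η ^ 3) ≤ _))
    · rw [deriv_fun_sub ((hχC _ hnN).differentiable one_ne_zero x)
        (hmap.differentiable one_ne_zero x)]
      exact (hmain x hx).2
    · rw [pow_one, mul_right_comm, ← div_eq_mul_inv, le_div_iff₀ hη]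
      refine le_trans ?_ hbound
      calc (A i * (τ * η ^ 4) + A i * (τ * η ^ 3)) * η
          = A i * (η + 1) * (τ * η ^ 4) := by ring
        _ ≤ S * (L + 1) * (τ * η ^ 4) := by gcongr
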